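/- **Model.** Legitimate nodes $\Phi_l$ and eavesdroppers (EDs) $\Phi_e$ form independent Poisson point processes in $\mathbb R^2$ with densities $\lambda_l,\lambda_e\ge 0$. Time is slotted, $k=0,1,2,\dots$; in every slot every legitimate node transmits with probability $p\in[0,1]$ and otherwise receives, independently over nodes and slots and independently of $\Phi_l,\Phi_e$. Fix $\eta,\beta_l,\beta_e>0$. In slot $k$ there is a *link* from $x$ to $y$ if $x$ transmits, $y$ receives, $\|x-y\|<\eta$, and the disk of radius $\beta_l\|x-y\|$ around $y$ contains no transmitting node other than $x$. An ED *decodes* a hop from $x$ to $y$ if it lies in the disk of radius $\beta_e\|x-y\|$ around $x$; a link is *secure* if no ED decodes it. A *causal route* is a finite sequence of hops used in strictly increasing slots (the trivial route from a node to itself is allowed). **Direct-path scheme (nsp).** A packet travels along a causal route all of whose links are secure. **Split-path scheme (sp).** A *split path* from $x$ to $y$ consists of two different non-trivial causal routes from $x$ to $y$ of (not necessarily secure) links, one for each of two sub-packets, such that no ED decodes both sub-packets (an ED decodes a sub-packet if it decodes some hop of its route). A packet travels along a *two-secure path*: a finite chain of stages, each of which is a secure link or a split path, each stage beginning only after the preceding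 ones are complete. For each scheme, a *giant component* is an infinite set $C\subseteq\Phi_l$ such that for all $x,y\in C$ a packet can travel from $x$ to $y$ within finitely many slots; let $\mathcal S_{\rm nsp}$, $\mathcal S_{\rm sp}$ be the events that a giant component exists under the direct-path scheme and under the split-path scheme. For nodes $x,y$ the minimum delay under a scheme is the least $k\ge 0$ such that a packet can travel from $x$ to $y$ using only the slots $0,\dots,k$ ($\infty$ if there is none). **Lemma.** (i) $\Pr\{\mathcal S_{\rm nsp}\}\le \Pr\{\mathcal S_{\rm sp}\}$. (ii) Let $\mathcal G$ denote the giant component of either one of the two schemes (the set of all nodes that belong to a giant component of that scheme), and suppose that it exists with positive probability. For $n\in\mathbb N$ let $x_0^*$ and $x_n^*$ be the nodes of $\mathcal G$ closest to $(0,0)$ and to $(n,0)$, and let $T_{\rm nsp}(0,n)$, $T_{\rm sp}(0,n)\in[0,\infty]$ be the minimum delays from $x_0^*$ to $x_n^*$ under the two schemes. Then, with $\mathbb E_{|\mathcal G}$ the expectation conditioned on the existence of $\mathcal G$, $$\mathbb E_{|\mathcal G}\,T_{\rm sp}(0,n)\ \le\ \mathbb E_{|\mathcal G}\,T_{\rm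 nsp}(0,n).$$ -/

import Mathlib

open MeasureTheory ProbabilityTheory Set
open scoped ENNReal NNReal

namespace SecureNet

noncomputable section

/-- The Euclidean plane. -/
abbrev Plane : Type := EuclideanSpace ℝ (Fin 2)

/-- The parameters of the model: densities `lamL`, `lamE` of the legitimate nodes and of the
eavesdroppers, slotted-ALOHA transmission probability `p`, communication radius `eta`, interference
parameter `betaL` and eavesdropping parameter `betaE`. -/
structure Params where
  lamL : ℝ≥0
  lamE : ℝ≥0
  p : ℝ
  eta : ℝ
  betaL : ℝ
  betaE : ℝ
  p_mem : p ∈ Icc (0 : ℝ) 1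
  eta_pos : 0 < eta
  betaL_pos : 0 < betaL
  betaE_pos : 0 < betaE

/-! ### One realization of the network -/

/-- One realization of the network. The legitimate nodes are the points `pos i`, `i ∈ nodes`; the
eavesdroppers form the set `eve`; `tx k i` says that the ALOHA protocol lets node `i` transmit in
slot `k`. -/
structure Realization where
  nodes : Set ℕ
  pos : ℕ → Plane
  eve : Set Plane
  tx : ℕ → ℕ → Prop

namespace Realization

variable (par : Params) (R : Realization)

/-- The (labels of the) nodes that transmit in slot `k`. -/
def transmitters (k : ℕ) : Set ℕ := {i | i ∈ R.nodes ∧ R.tx k i}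

/-- The nodes that receive in slot `k`: by half-duplex, those that do not transmit. -/
def receivers (k : ℕ) : Set ℕ := {i | i ∈ R.nodes ∧ ¬ R.tx k i}

/-- Single-hop connectivity from `i` to `j` in slot `k` without the security constraint: `i`
transmits, `j` receives, they are at distance less than `eta`, and the disk of radius
`betaL * ‖x_i - x_j‖` around the receiver contains no other transmitting node. -/
def Link (k i j : ℕ) : Prop :=
  i ∈ R.transmitters k ∧ j ∈ R.receivers k ∧
    dist (R.pos i) (R.pos j) < par.eta ∧
    ∀ w ∈ R.transmitters k, w ≠ i →
      R.pos w ∉ Metric.closedBall (R.pos j) (par.betaL * dist (R.pos i) (R.pos j))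

/-- An eavesdropper at `e` decodes a message sent from `i` to `j`. -/
def HopDecodedBy (e : Plane) (i j : ℕ) : Prop :=
  e ∈ Metric.closedBall (R.pos i) (par.betaE * dist (R.pos i) (R.pos j))

/-- The edges of slot `k` of the secure connectivity graph: links whose disk of radius
`betaE * ‖x_i - x_j‖` around the transmitter contains no eavesdropper. -/
def SecureLink (k i j : ℕ) : Prop :=
  R.Link par k i j ∧ ∀ e ∈ R.eve, ¬ R.HopDecodedBy par e i j

/-- `z 0 = i, z 1, …, z N = j` together with the slots `s 0 < s 1 < … < s (N - 1)`, all of them in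
`{a, …, b}`, is a causal route for the time-varying graph with edges `E`. The route with `N = 0` is
the trivial route from a node to itself. -/
def IsCausalRoute (E : ℕ → ℕ → ℕ → Prop) (a b i j N : ℕ) (z s : ℕ → ℕ) : Prop :=
  z 0 = i ∧ z N = j ∧
    (∀ l < N, a ≤ s l ∧ s l ≤ b ∧ E (s l) (z l) (z (l + 1))) ∧
    ∀ l m, l < m → m < N → s l < s m

/-- There is a direct path from `i` to `j` in the slots `a, …, b`: a causal route each of whose
hops is secure. -/
def DirectPath (a b i j : ℕ) : Prop :=
  ∃ (N : ℕ) (z s : ℕ → ℕ), IsCausalRoute (R.SecureLink par) a b i j N z s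

/-- An eavesdropper at `e` decodes the sub-packet that travels along `z 0, …, z N`, that is, it
decodes one of its hops. -/
def RouteDecodedBy (e : Plane) (N : ℕ) (z : ℕ → ℕ) : Prop :=
  ∃ l < N, R.HopDecodedBy par e (z l) (z (l + 1))

/-- There is a split path from `i` to `j` in the slots `a, …, b`: two different causal routes from
`i` to `j`, one for each sub-packet, whose hops need not be secure, such that no eavesdropper
decodes both sub-packets. -/
def SplitPath (a b i j : ℕ) : Prop :=
  ∃ (N : ℕ) (z s : ℕ → ℕ) (N' : ℕ) (z' s' : ℕ → ℕ),
    0 < N ∧ IsCausalRoute (R.Link par) a b i j N z s ∧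
    0 < N' ∧ IsCausalRoute (R.Link par) a b i j N' z' s' ∧
    ¬ (N = N' ∧ ∀ l ≤ N, z l = z' l) ∧
    ∀ e ∈ R.eve, ¬ (R.RouteDecodedBy par e N z ∧ R.RouteDecodedBy par e N' z')

/-- There is a two-secure path from `i` to `j` in the slots `a, …, b`: a chain of nodes
`z 0 = i, …, z N = j` in which the packet is passed from `z l` to `z (l + 1)` during the slots
`s l, …, t l`, either over a secure link or over a split path, and each stage starts after the
preceding ones are complete. -/
def TwoSecurePath (a b i j : ℕ) : Prop :=
  ∃ (N : ℕ) (z s t : ℕ → ℕ), z 0 = i ∧ z N = j ∧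
    (∀ l < N, a ≤ s l ∧ t l ≤ b ∧
      ((∃ k, s l ≤ k ∧ k ≤ t l ∧ R.SecureLink par k (z l) (z (l + 1))) ∨
        R.SplitPath par (s l) (t l) (z l) (z (l + 1)))) ∧
    ∀ l m, l < m → m < N → t l < s m

end Realization

/-- The two packet forwarding schemes. -/
inductive Scheme : Type
  | direct
  | split

namespace Realization

variable (par : Params) (R : Realization)

/-- Under the given scheme a packet can be brought from `i` to `j` within the slots `a, …, b`. -/
def PathWithin : Scheme → ℕ → ℕ → ℕ → ℕ → Prop
  | Scheme.direct => R.DirectPath par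
  | Scheme.split => R.TwoSecurePath par

/-- Existence of a causal multi-hop secure path from `i` to `j` under the given scheme. -/
def Connected (σ : Scheme) (i j : ℕ) : Prop := ∃ b, R.PathWithin par σ 0 b i j

/-- `C` is an infinite set of legitimate nodes any two of which are securely connected, in both
directions. -/
def IsGiant (σ : Scheme) (C : Set ℕ) : Prop :=
  C ⊆ R.nodes ∧ C.Infinite ∧ ∀ i ∈ C, ∀ j ∈ C, R.Connected par σ i j

/-- The nodes of the giant component. -/
def giant (σ : Scheme) : Set ℕ := {i | ∃ C, R.IsGiant par σ C ∧ i ∈ C}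

/-- The minimum delay from `i` to `j`: the least `k` such that the slots `0, …, k` suffice to bring
a packet from `i` to `j` under the scheme; it is infinite if there is no such `k`. -/
def delay (σ : Scheme) (i j : ℕ) : ℝ≥0∞ :=
  ⨅ (k : ℕ) (_ : R.PathWithin par σ 0 k i j), (k : ℝ≥0∞)

/-- `i` is an element of the set `C` of nodes that is closest to the point `x`. -/
def IsNearest (C : Set ℕ) (x : Plane) (i : ℕ) : Prop :=
  i ∈ C ∧ ∀ j ∈ C, dist (R.pos i) x ≤ dist (R.pos j) x

/-- `T(0, n)`: the minimum delay, under the scheme `σ`, from the node of the set `C` that is closest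
to `(0, 0)` to the node of `C` that is closest to `(n, 0)`. For the point processes considered below
ties have probability zero; here they are resolved in favour of the smallest delay. -/
def delayTo (σ : Scheme) (C : Set ℕ) (n : ℕ) : ℝ≥0∞ :=
  ⨅ (i : ℕ) (_ : R.IsNearest C !₂[(0 : ℝ), 0] i)
    (j : ℕ) (_ : R.IsNearest C !₂[(n : ℝ), 0] j), R.delay par σ i j

end Realization

/-! ### The random network -/

/-- A point process in the plane through an enumeration of its points: the points are `pt i` for
`i < card`, where the number `card` of points may be infinite. -/
structure PointProcess (Ω : Type*) where
  card : Ω → ℕ∞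
  pt : ℕ → Ω → Plane

namespace PointProcess

variable {Ω : Type*} (Φ : PointProcess Ω)

/-- The labels of the points of the process. -/
def labels (ω : Ω) : Set ℕ := {i | (i : ℕ∞) < Φ.card ω}

/-- The number of points in the set `A`. -/
def count (A : Set Plane) (ω : Ω) : ℕ∞ := {i | i ∈ Φ.labels ω ∧ Φ.pt i ω ∈ A}.encard

/-- The process with its enumeration, as one random element. -/
def toRandom (ω : Ω) : ℕ∞ × (ℕ → Plane) := (Φ.card ω, fun i => Φ.pt i ω)

/-- `Φ` is a Poisson point process of density `lam` on the plane: the number of points in a Borel set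
of finite area is Poisson distributed with mean `lam` times the area, and the numbers of points in
disjoint Borel sets are independent. -/
structure IsPoisson [MeasurableSpace Ω] (P : Measure Ω) (lam : ℝ≥0) : Prop where
  measurable_card : Measurable Φ.card
  measurable_pt : ∀ i, Measurable (Φ.pt i)
  law_count : ∀ A : Set Plane, MeasurableSet A → volume A ≠ ∞ →
    P.map (Φ.count A) =
      (poissonMeasure (lam * (volume A).toNNReal)).map (fun m : ℕ => (m : ℕ∞))
  indep_count : ∀ (m : ℕ) (A : Fin m → Set Plane), (∀ a, MeasurableSet (A a)) →
    Pairwise (fun a b => Disjoint (A a) (A b)) → iIndepFun (fun a => Φ.count (A a)) P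

end PointProcess

/-- The random data of the network: legitimate nodes, eavesdroppers, and the ALOHA decisions
(`tx k i ω = true` if node `i` is to transmit in slot `k`). -/
structure Network (Ω : Type*) where
  legit : PointProcess Ω
  eve : PointProcess Ω
  tx : ℕ → ℕ → Ω → Bool

namespace Network

variable {Ω : Type*} (net : Network Ω)

/-- The law of the network: the legitimate nodes and the eavesdroppers are independent Poisson
point processes of densities `lamL` and `lamE`, and, independently of these, each node transmits
in each slot with probability `p`, independently over nodes and slots. -/
structure HasLaw [MeasurableSpace Ω] (P : Measure Ω) (par : Params) : Prop where
  legit_poisson : net.legit.IsPoisson P par.lamL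
  eve_poisson : net.eve.IsPoisson P par.lamE
  measurable_tx : ∀ k i, Measurable (net.tx k i)
  prob_tx : ∀ k i, P {ω | net.tx k i ω = true} = ENNReal.ofReal par.p
  indep_tx : iIndepFun (fun (q : ℕ × ℕ) => net.tx q.1 q.2) P
  indep_legit_eve : IndepFun net.legit.toRandom net.eve.toRandom P
  indep_points_tx : IndepFun (fun ω => (net.legit.toRandom ω, net.eve.toRandom ω))
    (fun ω (q : ℕ × ℕ) => net.tx q.1 q.2 ω) P

/-- The realization of the network at the outcome `ω`. -/
def realization (ω : Ω) : Realization where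
  nodes := net.legit.labels ω
  pos := fun i => net.legit.pt i ω
  eve := {e | ∃ i ∈ net.eve.labels ω, net.eve.pt i ω = e}
  tx := fun k i => net.tx k i ω = true

/-- The event that a giant component exists under the scheme `σ`. -/
def giantExists (par : Params) (σ : Scheme) : Set Ω :=
  {ω | ∃ C, (net.realization ω).IsGiant par σ C}

/-- The conditional expectation, given that a giant component of the scheme `γ` exists, of the
minimum delay under the scheme `σ` between the nodes of that giant component that are closest to
`(0, 0)` and to `(n, 0)`. -/
def condMeanDelay [MeasurableSpace Ω] (P : Measure Ω) (par : Params) (γ σ : Scheme) (n : ℕ) :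
    ℝ≥0∞ :=
  ∫⁻ ω, (net.realization ω).delayTo par σ ((net.realization ω).giant par γ) n
    ∂(P[|net.giantExists par γ])

end Network

end

end SecureNet

/-!
A secure link used in slot `k` is a two-secure stage that starts and ends in slot `k`, so a direct
path is a two-secure path within the same slots. At every outcome, therefore, a giant component of
the direct-path scheme is also one of the split-path scheme, and the split-path scheme is at least
as fast between any two nodes, whichever component these were selected from. Both inequalities
follow by monotonicity of measure and integral.
-/

namespace SecureNet

namespace Realization

variable {par : Params} {R : Realization} {σ τ : Scheme}

theorem DirectPath.twoSecurePath {a b i j : ℕ} (h : R.DirectPath par a b i j) :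
    R.TwoSecurePath par a b i j := by
  obtain ⟨N, z, s, hstart, hend, hhops, hs⟩ := h
  refine ⟨N, z, s, s, hstart, hend, fun l hl => ?_, hs⟩
  obtain ⟨hal, hlb, hsecure⟩ := hhops l hl
  exact ⟨hal, hlb, Or.inl ⟨s l, le_rfl, le_rfl, hsecure⟩⟩

theorem IsGiant.mono {C : Set ℕ}
    (hστ : ∀ b i j, R.PathWithin par σ 0 b i j → R.PathWithin par τ 0 b i j)
    (hC : R.IsGiant par σ C) : R.IsGiant par τ C := by
  obtain ⟨hnodes, hinf, hconn⟩ := hC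
  exact ⟨hnodes, hinf, fun i hi j hj => (hconn i hi j hj).imp fun b => hστ b i j⟩

theorem delay_anti {i j : ℕ}
    (hστ : ∀ b, R.PathWithin par σ 0 b i j → R.PathWithin par τ 0 b i j) :
    R.delay par τ i j ≤ R.delay par σ i j :=
  biInf_mono hστ

theorem delayTo_anti
    (hστ : ∀ b i j, R.PathWithin par σ 0 b i j → R.PathWithin par τ 0 b i j)
    (C : Set ℕ) (n : ℕ) : R.delayTo par τ C n ≤ R.delayTo par σ C n :=
  iInf₂_mono fun i _ => iInf₂_mono fun j _ => delay_anti fun b => hστ b i j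

end Realization

namespace Network

variable {Ω : Type*} {net : Network Ω} {par : Params} {σ τ : Scheme}

theorem giantExists_mono
    (hστ : ∀ ω b i j, (net.realization ω).PathWithin par σ 0 b i j →
      (net.realization ω).PathWithin par τ 0 b i j) :
    net.giantExists par σ ⊆ net.giantExists par τ :=
  fun ω => Exists.imp fun _ => Realization.IsGiant.mono (hστ ω)

theorem condMeanDelay_anti [MeasurableSpace Ω]
    (hστ : ∀ ω b i j, (net.realization ω).PathWithin par σ 0 b i j →
      (net.realization ω).PathWithin par τ 0 b i j)
    (P : Measure Ω) (γ : Scheme) (n : ℕ) :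
    net.condMeanDelay P par γ τ n ≤ net.condMeanDelay P par γ σ n :=
  lintegral_mono fun ω => Realization.delayTo_anti (hστ ω) _ n

end Network

end SecureNet

theorem mainTheorem11_general {Ω : Type*} [MeasurableSpace Ω] (P : MeasureTheory.Measure Ω)
    [MeasureTheory.IsFiniteMeasure P] (par : SecureNet.Params) (net : SecureNet.Network Ω) :
    P (net.giantExists par SecureNet.Scheme.direct) ≤
        P (net.giantExists par SecureNet.Scheme.split) ∧
      ∀ γ : SecureNet.Scheme, P (net.giantExists par γ) ≠ 0 → ∀ n : ℕ,
        net.condMeanDelay P par γ SecureNet.Scheme.split n ≤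
          net.condMeanDelay P par γ SecureNet.Scheme.direct n := by
  have split_of_direct (ω : Ω) (b i j : ℕ)
      (h : (net.realization ω).PathWithin par SecureNet.Scheme.direct 0 b i j) :
      (net.realization ω).PathWithin par SecureNet.Scheme.split 0 b i j :=
    SecureNet.Realization.DirectPath.twoSecurePath h
  exact ⟨MeasureTheory.measure_mono (SecureNet.Network.giantExists_mono split_of_direct),
    fun γ _ n => SecureNet.Network.condMeanDelay_anti split_of_direct P γ n⟩

theorem mainTheorem11 {Ω : Type*} [MeasurableSpace Ω] (P : MeasureTheory.Measure Ω)
    [MeasureTheory.IsProbabilityMeasure P] (par : SecureNet.Params) (net : SecureNet.Network Ω)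
    (hnet : net.HasLaw P par) :
    P (net.giantExists par SecureNet.Scheme.direct) ≤
        P (net.giantExists par SecureNet.Scheme.split) ∧
      ∀ γ : SecureNet.Scheme, P (net.giantExists par γ) ≠ 0 → ∀ n : ℕ,
        net.condMeanDelay P par γ SecureNet.Scheme.split n ≤
          net.condMeanDelay P par γ SecureNet.Scheme.direct n :=
  mainTheorem11_general P par net
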